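/- Let $0<p<1$. The base-$2$ stochastic adding machine is the Markov chain on $\mathbb{N}=\{0,1,2,\dots\}$ whose one-step transition from $N=\sum_{i\ge 0}\varepsilon_i 2^i$ (with $\varepsilon_i\in\{0,1\}$) is obtained as follows: let $(e_i)_{i\ge 0}$ be independent random variables with $P(e_i=1)=p$ and $P(e_i=0)=1-p$, put $c_{-1}=1$ and, for $i\ge 0$, $c_i=\lfloor(\varepsilon_i+e_ic_{i-1})/2\rfloor$; then $N$ moves to $\sum_{i\ge0}\varepsilon_i'2^i$, where $\varepsilon_i'\in\{0,1\}$ and $\varepsilon_i'\equiv\varepsilon_i+e_ic_{i-1}\pmod 2$. Let $S_p=((S_p)_{n,m})_{n,m\in\mathbb{N}}$ be its transition matrix, acting on complex sequences by $(S_pv)_n=\sum_{m}(S_p)_{n,m}v_m$. Let $f(z)=\left(\frac{z-(1-p)}{p}\right)^2$ and let $J(f)=\{z\in\mathbb{C}: |f^{n}(z)|\not\to\infty\}$ be its filled Julia set, where $f^n$ is the $n$-th iterate. For a bounded operator $T$ on a complex Banach space, let $\sigma(T)$ be its spectrum. The point spectrum consists of the $\lambda$ for which $T-\lambda$ is not injective,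 the continuous spectrum of the $\lambda$ for which $T-\lambda$ is injective, not onto and has dense range, and the residual spectrum of the $\lambda$ for which $T-\lambda$ is injective and does not have dense range. Then $S_p$ defines a bounded operator on each of the complex sequence spaces $c_0$ (null sequences), $c$ (convergent sequences), both with the supremum norm, and $\ell^\alpha$, $1\le\alpha<\infty$, and on each of these spaces $\sigma(S_p)=J(f)$. More precisely: (i) on $c_0$, and on $\ell^\alpha$ for every $1<\alpha<\infty$, the continuous spectrum of $S_p$ equals $J(f)$, and the point and residual spectra are empty; (ii) on $c$, the point spectrum of $S_p$ is $\{1\}$, the residual spectrum is empty, and the continuous spectrum is $J(f)\setminus\{1\}$. -/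

import Mathlib

open MeasureTheory ProbabilityTheory Filter Topology
open scoped ENNReal ZeroAtInfty

/-! ### Parts of the spectrum of a bounded operator -/

section Spectra

variable {E : Type*} [NormedAddCommGroup E] [NormedSpace ℂ E]

/-- The point spectrum: the `z` for which `T - z` is not injective. -/
def pointSpectrum (T : E →L[ℂ] E) : Set ℂ :=
  {z | ¬ Function.Injective (T - z • ContinuousLinearMap.id ℂ E)}

/-- The continuous spectrum: the `z` for which `T - z` is injective, not onto, and has dense
range. -/
def contSpectrum (T : E →L[ℂ] E) : Set ℂ :=
  {z | Function.Injective (T - z • ContinuousLinearMap.id ℂ E) ∧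
    ¬ Function.Surjective (T - z • ContinuousLinearMap.id ℂ E) ∧
    DenseRange (T - z • ContinuousLinearMap.id ℂ E)}

/-- The residual spectrum: the `z` for which `T - z` is injective and does not have dense
range. -/
def residualSpectrum (T : E →L[ℂ] E) : Set ℂ :=
  {z | Function.Injective (T - z • ContinuousLinearMap.id ℂ E) ∧
    ¬ DenseRange (T - z • ContinuousLinearMap.id ℂ E)}

end Spectra

/-- The Banach space `c` of convergent complex sequences, as a subspace of `ℓ^∞` with the
supremum norm. -/
def convergentSeq : Submodule ℂ (lp (fun _ : ℕ => ℂ) ∞) where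
  carrier := {v | ∃ l : ℂ, Tendsto (fun n => v n) atTop (𝓝 l)}
  add_mem' := by
    rintro v w ⟨l, hl⟩ ⟨m, hm⟩
    exact ⟨l + m, hl.add hm⟩
  zero_mem' := ⟨0, tendsto_const_nhds⟩
  smul_mem' := by
    rintro a v ⟨l, hl⟩
    exact ⟨a * l, hl.const_mul a⟩

/-! ### The stochastic adding machine in base 2 -/

namespace AddingMachine

/-- The `i`-th binary digit of `N`. -/
def digit (N i : ℕ) : ℕ := N / 2 ^ i % 2

/-- The carries of one step of the machine started at `N`, where the bit `e i` says whether the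
carry arriving at position `i` is taken into account. The index is shifted by one:
`carry N e i` is the carry arriving at position `i`, and the initial carry is `1`. -/
def carry (N : ℕ) (e : ℕ → Bool) : ℕ → ℕ
  | 0 => 1
  | i + 1 => (digit N i + (e i).toNat * carry N e i) / 2

/-- The `i`-th binary digit of the number that the machine reaches from `N` in one step. -/
def nextDigit (N : ℕ) (e : ℕ → Bool) (i : ℕ) : ℕ :=
  (digit N i + (e i).toNat * carry N e i) % 2

/-- The law of a sequence of independent bits, each equal to `1` with probability `p` and to `0`
with probability `1 - p`. -/
noncomputable def bitLaw (p : unitInterval) : Measure (ℕ → Bool) :=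
  Measure.infinitePi fun _ : ℕ => bernoulliMeasure true false p

/-- The probability that the machine moves from `N` to `M` in one step. -/
noncomputable def transitionProb (p : unitInterval) (N M : ℕ) : ℝ :=
  (bitLaw p).real {e | ∀ i, nextDigit N e i = digit M i}

/-- `w` is the image of the sequence `v` under the transition matrix `S_p` of the machine (acting
on column vectors): `w n = ∑ m, (S_p)_{n,m} v m` for every `n`, with convergent series. -/
def IsImage (p : unitInterval) (v w : ℕ → ℂ) : Prop :=
  ∀ n, HasSum (fun m => (transitionProb p n m : ℂ) * v m) (w n)

/-- The quadratic map `f(z) = ((z - (1 - p)) / p) ^ 2`. -/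
noncomputable def f (p : unitInterval) (z : ℂ) : ℂ :=
  ((z - (1 - ((p : ℝ) : ℂ))) / ((p : ℝ) : ℂ)) ^ 2

/-- The filled Julia set of `f`: the points whose orbit does not tend to infinity. -/
def filledJulia (p : unitInterval) : Set ℂ :=
  {z | ¬ Tendsto (fun n => ‖(f p)^[n] z‖) atTop atTop}

end AddingMachine

namespace AddingMachine

lemma digit_lt (N i : ℕ) : digit N i < 2 := Nat.mod_lt _ two_pos

lemma digit_two_mul_zero (n : ℕ) : digit (2 * n) 0 = 0 := by simp [digit]

lemma digit_two_mul_add_one_zero (n : ℕ) : digit (2 * n + 1) 0 = 1 := by simp [digit]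

lemma digit_two_mul_succ (n i : ℕ) : digit (2 * n) (i + 1) = digit n i := by
  rw [digit, digit, pow_succ', Nat.mul_div_mul_left _ _ two_pos]

lemma digit_two_mul_add_one_succ (n i : ℕ) : digit (2 * n + 1) (i + 1) = digit n i := by
  rw [digit, digit, pow_succ', ← Nat.div_div_eq_div_mul]
  congr 2
  omega

lemma digit_ext {n m : ℕ} (h : ∀ i, digit n i = digit m i) : n = m := by
  refine Nat.eq_of_testBit_eq fun i => ?_
  have := h i
  simp only [digit] at this
  simp [Nat.testBit_eq_decide_div_mod_eq, this]

lemma digit_injective_iff {n m : ℕ} : (∀ i, digit n i = digit m i) ↔ n = m :=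
  ⟨digit_ext, fun h _ => by rw [h]⟩

lemma carry_eq_zero_of_carry_one {N : ℕ} {e : ℕ → Bool} (h : carry N e 1 = 0) (i : ℕ) :
    carry N e (i + 1) = 0 := by
  induction i with
  | zero => exact h
  | succ i ih =>
    rw [carry, ih, mul_zero, add_zero]
    exact Nat.div_eq_of_lt (digit_lt _ _)

lemma nextDigit_succ_of_carry_one {N : ℕ} {e : ℕ → Bool} (h : carry N e 1 = 0) (i : ℕ) :
    nextDigit N e (i + 1) = digit N (i + 1) := by
  rw [nextDigit, carry_eq_zero_of_carry_one h, mul_zero, add_zero]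
  exact Nat.mod_eq_of_lt (digit_lt _ _)

lemma forall_nat_iff {P : ℕ → Prop} : (∀ i, P i) ↔ P 0 ∧ ∀ i, P (i + 1) :=
  ⟨fun h => ⟨h 0, fun i => h _⟩, fun h i => by cases i; exacts [h.1, h.2 _]⟩

lemma carry_one_even (n : ℕ) (e : ℕ → Bool) : carry (2 * n) e 1 = 0 := by
  have : (e 0).toNat < 2 := Bool.toNat_lt _
  simp [carry, digit_two_mul_zero, this]

lemma carry_odd_succ {n : ℕ} {e : ℕ → Bool} (h : e 0 = true) (i : ℕ) :
    carry (2 * n + 1) e (i + 1) = carry n (fun j => e (j + 1)) i := by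
  induction i with
  | zero => simp [carry, digit_two_mul_add_one_zero, h]
  | succ i ih => rw [carry, ih, digit_two_mul_add_one_succ, carry]

/-- The event that the machine moves from `N` to `M`. -/
def moves (N M : ℕ) : Set (ℕ → Bool) := {e | ∀ i, nextDigit N e i = digit M i}

lemma moves_even_even (n m : ℕ) (e : ℕ → Bool) :
    e ∈ moves (2 * n) (2 * m) ↔ e 0 = false ∧ n = m := by
  rw [moves, Set.mem_ofPred_eq, forall_nat_iff]
  simp_rw [nextDigit_succ_of_carry_one (carry_one_even n e), digit_two_mul_succ,
    digit_injective_iff]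
  cases h : e 0 <;> simp [nextDigit, carry, digit_two_mul_zero, h]

lemma moves_even_odd (n m : ℕ) (e : ℕ → Bool) :
    e ∈ moves (2 * n) (2 * m + 1) ↔ e 0 = true ∧ n = m := by
  rw [moves, Set.mem_ofPred_eq, forall_nat_iff]
  simp_rw [nextDigit_succ_of_carry_one (carry_one_even n e), digit_two_mul_succ,
    digit_two_mul_add_one_succ, digit_injective_iff]
  cases h : e 0 <;> simp [nextDigit, carry, digit_two_mul_zero, digit_two_mul_add_one_zero, h]

lemma moves_odd_odd (n m : ℕ) (e : ℕ → Bool) :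
    e ∈ moves (2 * n + 1) (2 * m + 1) ↔ e 0 = false ∧ n = m := by
  rw [moves, Set.mem_ofPred_eq, forall_nat_iff]
  cases h : e 0
  · have hc : carry (2 * n + 1) e 1 = 0 := by simp [carry, digit_two_mul_add_one_zero, h]
    simp_rw [nextDigit_succ_of_carry_one hc, digit_two_mul_add_one_succ, digit_injective_iff]
    simp [nextDigit, carry, digit_two_mul_add_one_zero, h]
  · simp [nextDigit, carry, digit_two_mul_add_one_zero, h]

lemma moves_odd_even (n m : ℕ) (e : ℕ → Bool) :
    e ∈ moves (2 * n + 1) (2 * m) ↔ e 0 = true ∧ (fun j => e (j + 1)) ∈ moves n m := by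
  rw [moves, Set.mem_ofPred_eq, forall_nat_iff]
  cases h : e 0
  · simp [nextDigit, carry, digit_two_mul_add_one_zero, digit_two_mul_zero, h]
  · simp [nextDigit, carry_odd_succ h, digit_two_mul_add_one_succ, digit_two_mul_succ, moves]
    simp [carry, digit_two_mul_add_one_zero, digit_two_mul_zero, h]

lemma measurable_carry (N i : ℕ) : Measurable fun e : ℕ → Bool => carry N e i := by
  induction i with
  | zero => exact measurable_const
  | succ i ih =>
    have h : Measurable fun e : ℕ → Bool => (e i).toNat :=
      (measurable_from_top (f := Bool.toNat)).comp (measurable_pi_apply i)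
    exact (measurable_from_top (f := fun k : ℕ => (digit N i + k) / 2)).comp (h.mul ih)

lemma measurableSet_moves (N M : ℕ) : MeasurableSet (moves N M) := by
  have h : Measurable fun e : ℕ → Bool => fun i => nextDigit N e i := by
    refine measurable_pi_lambda _ fun i => ?_
    have h : Measurable fun e : ℕ → Bool => (e i).toNat :=
      (measurable_from_top (f := Bool.toNat)).comp (measurable_pi_apply i)
    exact (measurable_from_top (f := fun k : ℕ => (digit N i + k) % 2)).comp
      (h.mul (measurable_carry N i))
  have : moves N M = (fun e i => nextDigit N e i) ⁻¹' {digit M} := by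
    ext e
    simp [moves, funext_iff]
  rw [this]
  exact h (measurableSet_singleton _)

/-- Prepend a bit to a sequence of bits. -/
def consBit (x : Bool × (ℕ → Bool)) : ℕ → Bool := fun i => Nat.casesOn i x.1 x.2

lemma measurable_consBit : Measurable consBit := by
  refine measurable_pi_lambda _ fun i => ?_
  cases i with
  | zero => exact measurable_fst
  | succ i => exact (measurable_pi_apply i).comp measurable_snd

instance (p : unitInterval) : IsProbabilityMeasure (bitLaw p) := by
  unfold bitLaw
  infer_instance

lemma map_consBit (p : unitInterval) :
    ((bernoulliMeasure true false p).prod (bitLaw p)).map consBit = bitLaw p := by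
  classical
  refine Measure.eq_infinitePi _ fun s t ht => ?_
  obtain ⟨N, hN⟩ := s.exists_nat_subset_range
  set t' : ℕ → Set Bool := fun i => if i ∈ s then t i else Set.univ with ht'
  have hs : s ⊆ Finset.range (N + 1) := hN.trans (Finset.range_mono N.le_succ)
  have hpi : Set.pi (s : Set ℕ) t = {e | ∀ i ∈ Finset.range (N + 1), e i ∈ t' i} := by
    ext e
    refine ⟨fun h i _ => ?_, fun h i hi => ?_⟩
    · by_cases hi : i ∈ s
      · simpa [ht', hi] using h i hi
      · simp [ht', hi]
    · simpa [ht', Finset.mem_coe.1 hi] using h i (hs hi)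
  have hpre : consBit ⁻¹' (Set.pi (s : Set ℕ) t) =
      t' 0 ×ˢ Set.pi (Finset.range N : Set ℕ) (fun i => t' (i + 1)) := by
    rw [hpi]
    ext x
    simp only [Set.mem_preimage, Set.mem_ofPred_eq, Set.mem_prod, Set.mem_pi, Finset.mem_coe,
      Finset.mem_range]
    refine ⟨fun h => ⟨h 0 (by simp), fun i hi => h (i + 1) (by omega)⟩, fun h i hi => ?_⟩
    cases i with
    | zero => exact h.1
    | succ i => exact h.2 i (by omega)
  have hprod : ∏ i ∈ s, bernoulliMeasure true false p (t i) =
      ∏ i ∈ Finset.range (N + 1), bernoulliMeasure true false p (t' i) := by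
    rw [← Finset.prod_subset hs fun i _ hi => by simp [ht', hi]]
    exact Finset.prod_congr rfl fun i hi => by simp [ht', hi]
  rw [Measure.map_apply measurable_consBit
    (MeasurableSet.pi s.countable_toSet fun i _ => ht i), hpre, Measure.prod_prod, hprod,
    Finset.prod_range_succ', mul_comm, bitLaw, Measure.infinitePi_pi]
  exact fun i _ => MeasurableSet.of_discrete

lemma bitLaw_real_head_tail (p : unitInterval) (b : Bool) {A : Set (ℕ → Bool)}
    (hA : MeasurableSet A) :
    (bitLaw p).real {e | e 0 = b ∧ (fun j => e (j + 1)) ∈ A} =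
      (bernoulliMeasure true false p).real {b} * (bitLaw p).real A := by
  have hm : MeasurableSet {e : ℕ → Bool | e 0 = b ∧ (fun j => e (j + 1)) ∈ A} := by
    refine MeasurableSet.inter
      (measurable_pi_apply (X := fun _ : ℕ => Bool) 0 (measurableSet_singleton b)) ?_
    exact (measurable_pi_lambda (fun (e : ℕ → Bool) j => e (j + 1))
      fun j => measurable_pi_apply (j + 1)) hA
  have hpre : consBit ⁻¹' {e : ℕ → Bool | e 0 = b ∧ (fun j => e (j + 1)) ∈ A} = {b} ×ˢ A := by
    ext x
    simp [consBit]
  conv_lhs => rw [← map_consBit p]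
  rw [map_measureReal_apply measurable_consBit hm, hpre, measureReal_prod_prod]

lemma bitLaw_real_head (p : unitInterval) (b : Bool) :
    (bitLaw p).real {e | e 0 = b} = (bernoulliMeasure true false p).real {b} := by
  simpa using bitLaw_real_head_tail p b MeasurableSet.univ

lemma transitionProb_eq (p : unitInterval) (N M : ℕ) :
    transitionProb p N M = (bitLaw p).real (moves N M) := rfl

lemma transitionProb_even_even (p : unitInterval) (n m : ℕ) :
    transitionProb p (2 * n) (2 * m) = if n = m then 1 - (p : ℝ) else 0 := by
  rw [transitionProb_eq, show moves (2 * n) (2 * m) = {e | e 0 = false ∧ n = m} from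
    Set.ext fun e => moves_even_even n m e]
  split_ifs with h <;> simp [h, bitLaw_real_head]

lemma transitionProb_even_odd (p : unitInterval) (n m : ℕ) :
    transitionProb p (2 * n) (2 * m + 1) = if n = m then (p : ℝ) else 0 := by
  rw [transitionProb_eq, show moves (2 * n) (2 * m + 1) = {e | e 0 = true ∧ n = m} from
    Set.ext fun e => moves_even_odd n m e]
  split_ifs with h <;> simp [h, bitLaw_real_head]

lemma transitionProb_odd_odd (p : unitInterval) (n m : ℕ) :
    transitionProb p (2 * n + 1) (2 * m + 1) = if n = m then 1 - (p : ℝ) else 0 := by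
  rw [transitionProb_eq, show moves (2 * n + 1) (2 * m + 1) = {e | e 0 = false ∧ n = m} from
    Set.ext fun e => moves_odd_odd n m e]
  split_ifs with h <;> simp [h, bitLaw_real_head]

lemma transitionProb_odd_even (p : unitInterval) (n m : ℕ) :
    transitionProb p (2 * n + 1) (2 * m) = p * transitionProb p n m := by
  rw [transitionProb_eq, show moves (2 * n + 1) (2 * m) =
    {e | e 0 = true ∧ (fun j => e (j + 1)) ∈ moves n m} from
    Set.ext fun e => moves_odd_even n m e, bitLaw_real_head_tail _ _ (measurableSet_moves n m),
    transitionProb_eq]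
  simp

end AddingMachine

namespace AddingMachine

lemma sq_norm_le_norm_f {p : unitInterval} (hp0 : 0 < p) {w : ℂ} (hw : 1 ≤ ‖w‖) :
    ‖w‖ ^ 2 ≤ ‖f p w‖ := by
  have hp : 0 < (p : ℝ) := hp0
  have hp1 : (p : ℝ) ≤ 1 := p.2.2
  have h1 : ‖((1 : ℂ) - ((p : ℝ) : ℂ))‖ = 1 - p := by
    rw [← Complex.ofReal_one, ← Complex.ofReal_sub, Complex.norm_real, Real.norm_eq_abs,
      abs_of_nonneg (by linarith)]
  have h2 : ‖w‖ - (1 - p) ≤ ‖w - (1 - ((p : ℝ) : ℂ))‖ := by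
    rw [← h1]
    exact norm_sub_norm_le _ _
  have h3 : ‖w‖ ≤ ‖w - (1 - ((p : ℝ) : ℂ))‖ / p := by
    rw [le_div_iff₀ hp]
    nlinarith
  rw [f, norm_pow, norm_div, Complex.norm_real, Real.norm_eq_abs, abs_of_pos hp]
  gcongr

lemma norm_iterate_le_one {p : unitInterval} (hp0 : 0 < p) {z : ℂ} (hz : z ∈ filledJulia p)
    (i : ℕ) : ‖(f p)^[i] z‖ ≤ 1 := by
  by_contra! h
  set w := (f p)^[i] z with hw
  have key (n : ℕ) : ‖w‖ ^ (n + 1) ≤ ‖(f p)^[n] w‖ := by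
    induction n with
    | zero => simp
    | succ n ih =>
      have h1 : 1 ≤ ‖(f p)^[n] w‖ := (one_le_pow₀ h.le).trans ih
      rw [Function.iterate_succ_apply']
      calc ‖w‖ ^ (n + 1 + 1) ≤ ‖w‖ ^ ((n + 1) * 2) := pow_le_pow_right₀ h.le (by omega)
        _ = (‖w‖ ^ (n + 1)) ^ 2 := pow_mul _ _ _
        _ ≤ ‖(f p)^[n] w‖ ^ 2 := by gcongr
        _ ≤ _ := sq_norm_le_norm_f hp0 h1
  refine hz ((tendsto_add_atTop_iff_nat i).1 ?_)
  refine tendsto_atTop_mono (fun n => ?_)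
    ((tendsto_pow_atTop_atTop_of_one_lt h).comp (tendsto_add_atTop_nat 1))
  rw [Function.iterate_add_apply, ← hw]
  exact key n

lemma mem_filledJulia_of_bounded {p : unitInterval} {z : ℂ} {C : ℝ}
    (h : ∀ n, ‖(f p)^[n] z‖ ≤ C) : z ∈ filledJulia p := fun ht =>
  let ⟨n, hn⟩ := (ht.eventually_gt_atTop C).exists
  (h n).not_gt hn

lemma f_mem_filledJulia {p : unitInterval} {z : ℂ} (hz : z ∈ filledJulia p) :
    f p z ∈ filledJulia p := fun h =>
  hz ((tendsto_add_atTop_iff_nat 1).1 h)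

lemma f_one {p : unitInterval} (hp0 : 0 < p) : f p 1 = 1 := by
  have hp : ((p : ℝ) : ℂ) ≠ 0 := by exact_mod_cast (show (0 : ℝ) < p from hp0).ne'
  simp [f, hp]

lemma one_mem_filledJulia {p : unitInterval} (hp0 : 0 < p) : (1 : ℂ) ∈ filledJulia p :=
  mem_filledJulia_of_bounded (C := 1) fun n => by simp [Function.iterate_fixed (f_one hp0) n]

end AddingMachine

/-- A Banach space of null sequences indexed by `ℕ` that is stable under restriction of sequences
to the even and to the odd integers and under the inverse extensions by zero, and on which
functionals are determined by their values at the unit vectors. -/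
structure DyadicSpace (X : Type*) [NormedAddCommGroup X] [NormedSpace ℂ X] where
  coord : ℕ → X →L[ℂ] ℂ
  ext : ∀ {v w : X}, (∀ n, coord n v = coord n w) → v = w
  tendsto_coord : ∀ v, Tendsto (fun n => coord n v) atTop (𝓝 0)
  evens : X →L[ℂ] X
  odds : X →L[ℂ] X
  spreadEven : X →L[ℂ] X
  spreadOdd : X →L[ℂ] X
  coord_evens : ∀ n v, coord n (evens v) = coord (2 * n) v
  coord_odds : ∀ n v, coord n (odds v) = coord (2 * n + 1) v
  coord_spreadEven_even : ∀ n v, coord (2 * n) (spreadEven v) = coord n v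
  coord_spreadEven_odd : ∀ n v, coord (2 * n + 1) (spreadEven v) = 0
  coord_spreadOdd_even : ∀ n v, coord (2 * n) (spreadOdd v) = 0
  coord_spreadOdd_odd : ∀ n v, coord (2 * n + 1) (spreadOdd v) = coord n v
  norm_evens_le : ‖evens‖ ≤ 1
  norm_spreadOdd_le : ‖spreadOdd‖ ≤ 1
  basis : ℕ → X
  coord_basis : ∀ n m, coord n (basis m) = if n = m then 1 else 0
  dual_ext : ∀ l : X →L[ℂ] ℂ, (∀ n, l (basis n) = 0) → l = 0

namespace DyadicSpace

variable {X : Type*} [NormedAddCommGroup X] [NormedSpace ℂ X] (D : DyadicSpace X)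

lemma forall_nat_iff_even_odd {P : ℕ → Prop} :
    (∀ n, P n) ↔ (∀ n, P (2 * n)) ∧ ∀ n, P (2 * n + 1) := by
  refine ⟨fun h => ⟨fun n => h _, fun n => h _⟩, fun h n => ?_⟩
  obtain ⟨k, rfl | rfl⟩ := n.even_or_odd'
  exacts [h.1 k, h.2 k]

lemma evens_spreadEven (v : X) : D.evens (D.spreadEven v) = v :=
  D.ext fun n => by rw [D.coord_evens, D.coord_spreadEven_even]

lemma evens_spreadOdd (v : X) : D.evens (D.spreadOdd v) = 0 :=
  D.ext fun n => by rw [D.coord_evens, D.coord_spreadOdd_even, map_zero]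

lemma odds_spreadEven (v : X) : D.odds (D.spreadEven v) = 0 :=
  D.ext fun n => by rw [D.coord_odds, D.coord_spreadEven_odd, map_zero]

lemma odds_spreadOdd (v : X) : D.odds (D.spreadOdd v) = v :=
  D.ext fun n => by rw [D.coord_odds, D.coord_spreadOdd_odd]

lemma ext_evens_odds {v w : X} (he : D.evens v = D.evens w) (ho : D.odds v = D.odds w) :
    v = w := by
  refine D.ext (forall_nat_iff_even_odd.2 ⟨fun n => ?_, fun n => ?_⟩)
  · rw [← D.coord_evens, he, D.coord_evens]
  · rw [← D.coord_odds, ho, D.coord_odds]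

lemma spreadEven_basis (n : ℕ) : D.spreadEven (D.basis n) = D.basis (2 * n) := by
  refine D.ext (forall_nat_iff_even_odd.2 ⟨fun m => ?_, fun m => ?_⟩)
  · simp [D.coord_spreadEven_even, D.coord_basis]
  · rw [D.coord_spreadEven_odd, D.coord_basis, if_neg (by omega)]

lemma spreadOdd_basis (n : ℕ) : D.spreadOdd (D.basis n) = D.basis (2 * n + 1) := by
  refine D.ext (forall_nat_iff_even_odd.2 ⟨fun m => ?_, fun m => ?_⟩)
  · rw [D.coord_spreadOdd_even, D.coord_basis, if_neg (by omega)]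
  · simp [D.coord_spreadOdd_odd, D.coord_basis]

/-- The `k`-th term of the series for the transition operator: the carry reaches position `k`, where
the bit is ignored or meets the digit `0`. -/
noncomputable def machineTerm (p : unitInterval) (k : ℕ) : X →L[ℂ] X :=
  (((p : ℝ) : ℂ) ^ k) • (D.spreadOdd ^ k *
    ((1 - ((p : ℝ) : ℂ)) • 1 + ((p : ℝ) : ℂ) • (D.spreadEven * D.odds)) * D.evens ^ k)

/-- The transition operator of the adding machine. -/
noncomputable def machine (p : unitInterval) : X →L[ℂ] X := ∑' k, D.machineTerm p k

lemma machineTerm_succ (p : unitInterval) (k : ℕ) :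
    D.machineTerm p (k + 1) = ((p : ℝ) : ℂ) • D.spreadOdd * D.machineTerm p k * D.evens := by
  simp only [machineTerm, pow_succ' D.spreadOdd, pow_succ D.evens, pow_succ ((p : ℝ) : ℂ),
    smul_mul_assoc, mul_smul_comm, smul_smul, mul_assoc]

variable {p : unitInterval}

lemma summable_machineTerm [CompleteSpace X] (hp1 : p < 1) : Summable (D.machineTerm p) := by
  set B : X →L[ℂ] X := (1 - ((p : ℝ) : ℂ)) • 1 + ((p : ℝ) : ℂ) • (D.spreadEven * D.odds) with hB
  have hpow {T : X →L[ℂ] X} (hT : ‖T‖ ≤ 1) (k : ℕ) : ‖T ^ k‖ ≤ 1 := by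
    induction k with
    | zero => exact ContinuousLinearMap.norm_id_le
    | succ k ih =>
      rw [pow_succ]
      exact (norm_mul_le _ _).trans (mul_le_one₀ ih (norm_nonneg _) hT)
  have hsum : Summable fun k => (p : ℝ) ^ k * ‖B‖ :=
    (summable_geometric_of_lt_one p.2.1 hp1).mul_right _
  refine Summable.of_norm_bounded hsum fun k => ?_
  rw [machineTerm, norm_smul, norm_pow, Complex.norm_real, Real.norm_eq_abs, abs_of_nonneg p.2.1]
  have hp := pow_nonneg p.2.1 k
  gcongr
  calc ‖D.spreadOdd ^ k * B * D.evens ^ k‖ ≤ ‖D.spreadOdd ^ k‖ * ‖B‖ * ‖D.evens ^ k‖ :=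
        norm_mul₃_le
    _ ≤ 1 * ‖B‖ * 1 := by
      gcongr
      exacts [hpow D.norm_spreadOdd_le k, hpow D.norm_evens_le k]
    _ = ‖B‖ := by ring

lemma machine_eq [CompleteSpace X] (hp1 : p < 1) :
    D.machine p = (1 - ((p : ℝ) : ℂ)) • 1 + ((p : ℝ) : ℂ) • (D.spreadEven * D.odds) +
      ((p : ℝ) : ℂ) • D.spreadOdd * D.machine p * D.evens := by
  have hs := D.summable_machineTerm hp1
  rw [machine]
  conv_lhs => rw [hs.tsum_eq_zero_add]
  simp_rw [machineTerm_succ]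
  rw [← hs.tsum_mul_left, ← (hs.mul_left _).tsum_mul_right]
  simp [machineTerm]

lemma machine_apply [CompleteSpace X] (hp1 : p < 1) (v : X) :
    D.machine p v = (1 - ((p : ℝ) : ℂ)) • v + ((p : ℝ) : ℂ) • D.spreadEven (D.odds v) +
      ((p : ℝ) : ℂ) • D.spreadOdd (D.machine p (D.evens v)) := by
  conv_lhs => rw [D.machine_eq hp1]
  rfl

lemma evens_machine [CompleteSpace X] (hp1 : p < 1) (v : X) :
    D.evens (D.machine p v) =
      (1 - ((p : ℝ) : ℂ)) • D.evens v + ((p : ℝ) : ℂ) • D.odds v := by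
  rw [D.machine_apply hp1]
  simp [evens_spreadEven, evens_spreadOdd]

lemma odds_machine [CompleteSpace X] (hp1 : p < 1) (v : X) :
    D.odds (D.machine p v) =
      (1 - ((p : ℝ) : ℂ)) • D.odds v + ((p : ℝ) : ℂ) • D.machine p (D.evens v) := by
  rw [D.machine_apply hp1]
  simp [odds_spreadEven, odds_spreadOdd]

lemma machine_spreadEven [CompleteSpace X] (hp1 : p < 1) (v : X) :
    D.machine p (D.spreadEven v) = (1 - ((p : ℝ) : ℂ)) • D.spreadEven v +
      ((p : ℝ) : ℂ) • D.spreadOdd (D.machine p v) := by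
  rw [D.machine_apply hp1]
  simp [evens_spreadEven, odds_spreadEven]

lemma machine_spreadOdd [CompleteSpace X] (hp1 : p < 1) (v : X) :
    D.machine p (D.spreadOdd v) = (1 - ((p : ℝ) : ℂ)) • D.spreadOdd v +
      ((p : ℝ) : ℂ) • D.spreadEven v := by
  rw [D.machine_apply hp1]
  simp [evens_spreadOdd, odds_spreadOdd]

open AddingMachine in
lemma isImage_machine [CompleteSpace X] (hp1 : p < 1) (v : X) :
    IsImage p (fun n => D.coord n v) (fun n => D.coord n (D.machine p v)) := by
  intro n
  beta_reduce
  induction n using Nat.strong_induction_on generalizing v with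
  | _ n ih =>
    obtain ⟨k, rfl | rfl⟩ := n.even_or_odd'
    · rw [← D.coord_evens, D.evens_machine hp1]
      simp only [map_add, map_smul, D.coord_evens, D.coord_odds, smul_eq_mul]
      refine HasSum.even_add_odd ?_ ?_
      · convert hasSum_single k fun m hm => ?_ using 1
        · simp [transitionProb_even_even]
        · simp [transitionProb_even_even, hm.symm]
      · convert hasSum_single k fun m hm => ?_ using 1
        · simp [transitionProb_even_odd]
        · simp [transitionProb_even_odd, hm.symm]
    · rw [← D.coord_odds, D.odds_machine hp1, map_add,
        add_comm (D.coord k _), map_smul, map_smul, D.coord_odds, smul_eq_mul, smul_eq_mul]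
      refine HasSum.even_add_odd ?_ ?_
      · simpa [transitionProb_odd_even, D.coord_evens, mul_assoc] using
          (ih k (by omega) (D.evens v)).mul_left ((p : ℝ) : ℂ)
      · convert hasSum_single k fun m hm => ?_ using 1
        · simp [transitionProb_odd_odd]
        · simp [transitionProb_odd_odd, hm.symm]

/-- The square root `(z - (1 - p)) / p` of `f z`. -/
noncomputable def root (p : unitInterval) (z : ℂ) : ℂ := (z - (1 - ((p : ℝ) : ℂ))) / ((p : ℝ) : ℂ)

lemma root_sq (z : ℂ) : root p z ^ 2 = AddingMachine.f p z := rfl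

lemma coe_ne_zero (hp0 : 0 < p) : ((p : ℝ) : ℂ) ≠ 0 := by
  exact_mod_cast (show (0 : ℝ) < p from hp0).ne'

lemma mul_root (hp0 : 0 < p) (z : ℂ) :
    ((p : ℝ) : ℂ) * root p z = z - (1 - ((p : ℝ) : ℂ)) :=
  mul_div_cancel₀ _ (coe_ne_zero hp0)

lemma norm_root_le_one (hp0 : 0 < p) {z : ℂ} (hz : z ∈ AddingMachine.filledJulia p) :
    ‖root p z‖ ≤ 1 := by
  have h := AddingMachine.norm_iterate_le_one hp0 hz 1
  rw [Function.iterate_one, ← root_sq, norm_pow] at h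
  exact (pow_le_one_iff_of_nonneg (norm_nonneg _) two_ne_zero).1 h

/-! ### Bijectivity and the spectrum -/

lemma machine_eq_smul_iff [CompleteSpace X] (hp0 : 0 < p) (hp1 : p < 1) {z : ℂ} {v w : X} :
    D.machine p v = z • v + w ↔
      D.odds v = root p z • D.evens v + ((p : ℝ) : ℂ)⁻¹ • D.evens w ∧
      D.machine p (D.evens v) = AddingMachine.f p z • D.evens v +
        ((p : ℝ) : ℂ)⁻¹ • (root p z • D.evens w + D.odds w) := by
  have hp := coe_ne_zero hp0
  have hz : z = ((p : ℝ) : ℂ) * root p z + (1 - ((p : ℝ) : ℂ)) := by rw [mul_root hp0]; ring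
  rw [← root_sq]
  generalize root p z = r at *
  subst hz
  have h1 : D.evens (D.machine p v) =
      D.evens ((((p : ℝ) : ℂ) * r + (1 - ((p : ℝ) : ℂ))) • v + w) ↔
      D.odds v = r • D.evens v + ((p : ℝ) : ℂ)⁻¹ • D.evens w := by
    rw [D.evens_machine hp1, map_add, map_smul]
    constructor
    · intro h
      have := congrArg (fun x => ((p : ℝ) : ℂ)⁻¹ • (x - (1 - ((p : ℝ) : ℂ)) • D.evens v)) h
      simp only [add_sub_cancel_left, inv_smul_smul₀ hp] at this
      rw [this]
      match_scalars <;> field_simp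
      ring
    · intro h
      rw [h]
      match_scalars <;> field_simp
      ring
  have h2 (ho : D.odds v = r • D.evens v + ((p : ℝ) : ℂ)⁻¹ • D.evens w) :
      D.odds (D.machine p v) =
        D.odds ((((p : ℝ) : ℂ) * r + (1 - ((p : ℝ) : ℂ))) • v + w) ↔
      D.machine p (D.evens v) = r ^ 2 • D.evens v +
        ((p : ℝ) : ℂ)⁻¹ • (r • D.evens w + D.odds w) := by
    rw [D.odds_machine hp1, map_add, map_smul, ho]
    constructor
    · intro h
      have := congrArg (fun x => ((p : ℝ) : ℂ)⁻¹ • (x - (1 - ((p : ℝ) : ℂ)) •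
        (r • D.evens v + ((p : ℝ) : ℂ)⁻¹ • D.evens w))) h
      simp only [add_sub_cancel_left, inv_smul_smul₀ hp] at this
      rw [this]
      match_scalars <;> field_simp
      all_goals ring
    · intro h
      rw [h]
      match_scalars <;> field_simp
      all_goals ring
  constructor
  · intro h
    have ho := h1.1 (by rw [h])
    exact ⟨ho, (h2 ho).1 (by rw [h])⟩
  · rintro ⟨ho, he⟩
    exact D.ext_evens_odds (h1.2 ho) ((h2 ho).2 he)

lemma sub_smul_id_apply (T : X →L[ℂ] X) (z : ℂ) (v : X) :
    (T - z • ContinuousLinearMap.id ℂ X) v = T v - z • v := rfl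

lemma bijective_of_bijective_f [CompleteSpace X] (hp0 : 0 < p) (hp1 : p < 1) {z : ℂ}
    (h : Function.Bijective
      (D.machine p - AddingMachine.f p z • ContinuousLinearMap.id ℂ X)) :
    Function.Bijective (D.machine p - z • ContinuousLinearMap.id ℂ X) := by
  constructor
  · rw [injective_iff_map_eq_zero]
    intro v hv
    rw [sub_smul_id_apply, sub_eq_zero, ← add_zero (z • v), D.machine_eq_smul_iff hp0 hp1] at hv
    have he : D.evens v = 0 := by
      refine (injective_iff_map_eq_zero _).1 h.1 _ ?_
      rw [sub_smul_id_apply, hv.2]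
      simp
    exact D.ext_evens_odds (by rw [he, map_zero]) (by rw [hv.1, he]; simp)
  · intro w
    obtain ⟨x, hx⟩ := h.2 (((p : ℝ) : ℂ)⁻¹ • (root p z • D.evens w + D.odds w))
    refine ⟨D.spreadEven x +
      D.spreadOdd (root p z • x + ((p : ℝ) : ℂ)⁻¹ • D.evens w), ?_⟩
    rw [sub_smul_id_apply, sub_eq_iff_eq_add', D.machine_eq_smul_iff hp0 hp1]
    rw [sub_smul_id_apply, sub_eq_iff_eq_add'] at hx
    simp only [map_add, evens_spreadEven, evens_spreadOdd, odds_spreadEven, odds_spreadOdd,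
      zero_add, add_zero]
    exact ⟨trivial, hx⟩

lemma mem_spectrum_iff_not_isUnit {T : X →L[ℂ] X} {z : ℂ} :
    z ∈ spectrum ℂ T ↔ ¬ IsUnit (T - z • ContinuousLinearMap.id ℂ X) := by
  rw [spectrum.mem_iff, ← IsUnit.neg_iff, neg_sub]
  rfl

lemma mem_spectrum_iff [CompleteSpace X] {T : X →L[ℂ] X} {z : ℂ} :
    z ∈ spectrum ℂ T ↔ ¬ Function.Bijective (T - z • ContinuousLinearMap.id ℂ X) := by
  rw [mem_spectrum_iff_not_isUnit, ← ContinuousLinearMap.isUnit_iff_bijective]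

lemma spectrum_subset_filledJulia [CompleteSpace X] (hp0 : 0 < p) (hp1 : p < 1) :
    spectrum ℂ (D.machine p) ⊆ AddingMachine.filledJulia p := by
  intro z hz
  have key (n : ℕ) : (AddingMachine.f p)^[n] z ∈ spectrum ℂ (D.machine p) := by
    induction n with
    | zero => exact hz
    | succ n ih =>
      rw [Function.iterate_succ_apply', mem_spectrum_iff]
      exact fun h => mem_spectrum_iff.1 ih (D.bijective_of_bijective_f hp0 hp1 h)
  exact AddingMachine.mem_filledJulia_of_bounded fun n =>
    spectrum.norm_le_norm_mul_of_mem (key n)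

/-- Truncation of the formal eigenvector for `z` to the integers below `2 ^ k`. -/
noncomputable def approxEigenvector (p : unitInterval) : ℕ → ℂ → X
  | 0, _ => D.basis 0
  | k + 1, z => D.spreadEven (approxEigenvector p k (AddingMachine.f p z)) +
      root p z • D.spreadOdd (approxEigenvector p k (AddingMachine.f p z))

lemma coord_zero_approxEigenvector (k : ℕ) (z : ℂ) :
    D.coord 0 (D.approxEigenvector p k z) = 1 := by
  induction k generalizing z with
  | zero => simp [approxEigenvector, D.coord_basis]
  | succ k ih =>
    have h1 := D.coord_spreadEven_even 0 (D.approxEigenvector p k (AddingMachine.f p z))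
    have h2 := D.coord_spreadOdd_even 0 (D.approxEigenvector p k (AddingMachine.f p z))
    rw [mul_zero] at h1 h2
    rw [approxEigenvector, map_add, map_smul, h1, h2, ih]
    simp

lemma machine_approxEigenvector_succ [CompleteSpace X] (hp0 : 0 < p) (hp1 : p < 1) (k : ℕ)
    (z : ℂ) :
    D.machine p (D.approxEigenvector p (k + 1) z) - z • D.approxEigenvector p (k + 1) z =
      ((p : ℝ) : ℂ) • D.spreadOdd (D.machine p (D.approxEigenvector p k (AddingMachine.f p z)) -
        AddingMachine.f p z • D.approxEigenvector p k (AddingMachine.f p z)) := by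
  rw [approxEigenvector]
  generalize D.approxEigenvector p k (AddingMachine.f p z) = x
  have hz : z = ((p : ℝ) : ℂ) * root p z + (1 - ((p : ℝ) : ℂ)) := by rw [mul_root hp0]; ring
  rw [← root_sq, map_add, map_smul, D.machine_spreadEven hp1, D.machine_spreadOdd hp1]
  generalize root p z = r at *
  subst hz
  simp only [map_sub, map_smul]
  module

lemma norm_machine_approxEigenvector_le [CompleteSpace X] (hp0 : 0 < p) (hp1 : p < 1) (k : ℕ)
    {z : ℂ} (hz : z ∈ AddingMachine.filledJulia p) :
    ‖D.machine p (D.approxEigenvector p k z) - z • D.approxEigenvector p k z‖ ≤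
      (p : ℝ) ^ k * (‖D.machine p (D.basis 0)‖ + ‖D.basis 0‖) := by
  induction k generalizing z with
  | zero =>
    have h := AddingMachine.norm_iterate_le_one hp0 hz 0
    rw [Function.iterate_zero_apply] at h
    rw [approxEigenvector, pow_zero, one_mul]
    refine (norm_sub_le _ _).trans ?_
    rw [norm_smul]
    gcongr
    exact mul_le_of_le_one_left (norm_nonneg _) h
  | succ k ih =>
    rw [D.machine_approxEigenvector_succ hp0 hp1, norm_smul, Complex.norm_real, Real.norm_eq_abs,
      abs_of_nonneg p.2.1, pow_succ', mul_assoc]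
    refine mul_le_mul_of_nonneg_left ?_ p.2.1
    exact (D.spreadOdd.le_of_opNorm_le D.norm_spreadOdd_le _).trans
      (by simpa using ih (AddingMachine.f_mem_filledJulia hz))

lemma filledJulia_subset_spectrum [CompleteSpace X] (hp0 : 0 < p) (hp1 : p < 1) :
    AddingMachine.filledJulia p ⊆ spectrum ℂ (D.machine p) := by
  intro z hz
  by_contra h
  rw [mem_spectrum_iff, not_not, ← ContinuousLinearMap.isUnit_iff_bijective] at h
  obtain ⟨R, hR⟩ := h.exists_left_inv
  set C := ‖D.machine p (D.basis 0)‖ + ‖D.basis 0‖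
  have key (k : ℕ) : 1 ≤ ‖D.coord 0‖ * (‖R‖ * ((p : ℝ) ^ k * C)) := by
    set w := D.approxEigenvector p k z with hw
    have hRw : R (D.machine p w - z • w) = w := DFunLike.congr_fun hR w
    calc (1 : ℝ) = ‖D.coord 0 w‖ := by rw [hw, D.coord_zero_approxEigenvector, norm_one]
      _ ≤ ‖D.coord 0‖ * ‖w‖ := (D.coord 0).le_opNorm w
      _ ≤ ‖D.coord 0‖ * (‖R‖ * ‖D.machine p w - z • w‖) := by
        gcongr
        nth_rw 1 [← hRw]
        exact R.le_opNorm _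
      _ ≤ _ := by
        gcongr
        exact D.norm_machine_approxEigenvector_le hp0 hp1 k hz
  have hlim : Tendsto (fun k : ℕ => ‖D.coord 0‖ * (‖R‖ * ((p : ℝ) ^ k * C))) atTop (𝓝 0) := by
    simpa using (((tendsto_pow_atTop_nhds_zero_of_lt_one p.2.1 hp1).mul_const C).const_mul
      ‖R‖).const_mul ‖D.coord 0‖
  exact absurd (ge_of_tendsto' hlim key) (by norm_num)

theorem spectrum_machine [CompleteSpace X] (hp0 : 0 < p) (hp1 : p < 1) :
    spectrum ℂ (D.machine p) = AddingMachine.filledJulia p :=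
  (D.spectrum_subset_filledJulia hp0 hp1).antisymm (D.filledJulia_subset_spectrum hp0 hp1)

/-! ### Injectivity -/

lemma eigenvector_evens_odds [CompleteSpace X] (hp0 : 0 < p) (hp1 : p < 1) {z : ℂ} {v : X}
    (hv : D.machine p v = z • v) :
    D.odds v = root p z • D.evens v ∧
      D.machine p (D.evens v) = AddingMachine.f p z • D.evens v := by
  rw [← add_zero (z • v), D.machine_eq_smul_iff hp0 hp1] at hv
  simpa using hv

lemma coord_eq_zero_of_eigenvector [CompleteSpace X] (hp0 : 0 < p) (hp1 : p < 1) (n : ℕ)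
    {z : ℂ} {v : X} (hv : D.machine p v = z • v) (h0 : D.coord 0 v = 0) : D.coord n v = 0 := by
  induction n using Nat.strong_induction_on generalizing z v with
  | _ n ih =>
    obtain ⟨ho, he⟩ := D.eigenvector_evens_odds hp0 hp1 hv
    obtain ⟨k, rfl | rfl⟩ := n.even_or_odd'
    · rcases k.eq_zero_or_pos with rfl | hk
      · exact h0
      · rw [← D.coord_evens]
        exact ih k (by omega) he (by rw [D.coord_evens]; exact h0)
    · rw [← D.coord_odds, ho, map_smul, D.coord_evens, ih (2 * k) (by omega) hv h0, smul_zero]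

lemma coord_two_pow_of_eigenvector [CompleteSpace X] (hp0 : 0 < p) (hp1 : p < 1) (k : ℕ)
    {z : ℂ} {v : X} (hv : D.machine p v = z • v) :
    D.coord (2 ^ k) v = root p ((AddingMachine.f p)^[k] z) * D.coord 0 v := by
  induction k generalizing z v with
  | zero =>
    have := D.coord_odds 0 v
    rw [(D.eigenvector_evens_odds hp0 hp1 hv).1, map_smul, D.coord_evens] at this
    simpa using this.symm
  | succ k ih =>
    rw [pow_succ', ← D.coord_evens, ih (D.eigenvector_evens_odds hp0 hp1 hv).2, D.coord_evens,
      Function.iterate_succ_apply]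

theorem injective_machine_sub [CompleteSpace X] (hp0 : 0 < p) (hp1 : p < 1) (z : ℂ) :
    Function.Injective (D.machine p - z • ContinuousLinearMap.id ℂ X) := by
  rw [injective_iff_map_eq_zero]
  intro v hv
  rw [sub_smul_id_apply, sub_eq_zero] at hv
  by_cases h0 : D.coord 0 v = 0
  · exact D.ext fun n => by rw [D.coord_eq_zero_of_eigenvector hp0 hp1 n hv h0, map_zero]
  exfalso
  have hroot : Tendsto (fun k : ℕ => root p ((AddingMachine.f p)^[k] z)) atTop (𝓝 0) := by
    have h := ((D.tendsto_coord v).comp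
      (tendsto_pow_atTop_atTop_of_one_lt (one_lt_two (α := ℕ)))).mul_const (D.coord 0 v)⁻¹
    rw [zero_mul] at h
    refine h.congr fun k => ?_
    simp only [Function.comp_apply]
    rw [D.coord_two_pow_of_eigenvector hp0 hp1 k hv, mul_inv_cancel_right₀ h0]
  have hstep : Tendsto (fun k : ℕ => root p ((AddingMachine.f p)^[k + 1] z)) atTop
      (𝓝 ((0 ^ 2 - (1 - ((p : ℝ) : ℂ))) / ((p : ℝ) : ℂ))) := by
    simp_rw [Function.iterate_succ_apply', ← root_sq]
    exact ((hroot.pow 2).sub_const _).div_const _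
  have h := tendsto_nhds_unique ((tendsto_add_atTop_iff_nat 1).2 hroot) hstep
  have hq : (1 : ℂ) - ((p : ℝ) : ℂ) ≠ 0 := by
    rw [sub_ne_zero]
    exact_mod_cast (show (p : ℝ) < 1 from hp1).ne'
  rw [eq_comm, div_eq_zero_iff] at h
  simp only [coe_ne_zero hp0, or_false] at h
  exact hq (by linear_combination -h)

/-! ### Density of the range -/

lemma left_eigenvector_spread [CompleteSpace X] (hp0 : 0 < p) (hp1 : p < 1) {z : ℂ}
    {l : X →L[ℂ] ℂ} (hl : ∀ v, l (D.machine p v) = z * l v) :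
    (∀ v, l (D.spreadEven v) = root p z * l (D.spreadOdd v)) ∧
      ∀ v, l (D.spreadOdd (D.machine p v)) = AddingMachine.f p z * l (D.spreadOdd v) := by
  have hp := coe_ne_zero hp0
  have hz := mul_root hp0 z
  have h1 (v : X) : l (D.spreadEven v) = root p z * l (D.spreadOdd v) := by
    have h := hl (D.spreadOdd v)
    rw [D.machine_spreadOdd hp1, map_add, map_smul, map_smul, smul_eq_mul, smul_eq_mul] at h
    refine mul_left_cancel₀ hp ?_
    linear_combination h - l (D.spreadOdd v) * hz
  refine ⟨h1, fun v => ?_⟩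
  have h := hl (D.spreadEven v)
  rw [D.machine_spreadEven hp1, map_add, map_smul, map_smul, smul_eq_mul, smul_eq_mul, h1] at h
  refine mul_left_cancel₀ hp ?_
  rw [← root_sq]
  linear_combination h - root p z * l (D.spreadOdd v) * hz

lemma norm_left_eigenvector_le [CompleteSpace X] (hp0 : 0 < p) (hp1 : p < 1) (k : ℕ) {z : ℂ}
    (hz : z ∈ AddingMachine.filledJulia p) {l : X →L[ℂ] ℂ}
    (hl : ∀ v, l (D.machine p v) = z * l v) {n : ℕ} (hn : n < 2 ^ k) :
    ‖l (D.basis n)‖ ≤ ‖l (D.basis (2 ^ k - 1))‖ := by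
  induction k generalizing z l n with
  | zero =>
    obtain rfl : n = 0 := by simpa using hn
    simp
  | succ k ih =>
    obtain ⟨h1, h2⟩ := D.left_eigenvector_spread hp0 hp1 hl
    have hk : 2 ^ (k + 1) - 1 = 2 * (2 ^ k - 1) + 1 := by
      have := Nat.one_le_two_pow (n := k)
      omega
    have key (m : ℕ) (hm : m < 2 ^ k) :
        ‖l (D.spreadOdd (D.basis m))‖ ≤ ‖l (D.basis (2 ^ (k + 1) - 1))‖ := by
      rw [hk, ← D.spreadOdd_basis]
      exact ih (AddingMachine.f_mem_filledJulia hz) (l := l.comp D.spreadOdd) h2 hm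
    obtain ⟨m, rfl | rfl⟩ := n.even_or_odd'
    · rw [← D.spreadEven_basis, h1, norm_mul]
      exact (mul_le_of_le_one_left (norm_nonneg _) (norm_root_le_one hp0 hz)).trans
        (key m (by omega))
    · rw [← D.spreadOdd_basis]
      exact key m (by omega)

lemma denseRange_of_forall_dual {T : X →L[ℂ] X}
    (h : ∀ l : X →L[ℂ] ℂ, (∀ v, l (T v) = 0) → l = 0) : DenseRange T := by
  by_contra hd
  set K : Submodule ℂ X := (LinearMap.range (T : X →ₗ[ℂ] X)).topologicalClosure with hK
  have hKc : IsClosed (K : Set X) := Submodule.isClosed_topologicalClosure _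
  obtain ⟨x, hx⟩ : ∃ x, x ∉ K := by
    by_contra! hall
    exact hd fun x => hall x
  have hne : ‖K.mkQL x‖ ≠ 0 := by
    rw [norm_ne_zero_iff]
    simpa using hx
  obtain ⟨g, -, hg⟩ := exists_dual_vector ℂ (K.mkQL x) hne
  have h0 := h (g.comp K.mkQL) fun v => by
    have hv : K.mkQL (T v) = 0 := by
      simpa using Submodule.le_topologicalClosure _ (LinearMap.mem_range_self (T : X →ₗ[ℂ] X) v)
    simp only [ContinuousLinearMap.comp_apply, hv, map_zero]
  have := DFunLike.congr_fun h0 x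
  rw [ContinuousLinearMap.comp_apply, hg] at this
  exact hne (by simpa using this)

theorem denseRange_machine_sub [CompleteSpace X] (hp0 : 0 < p) (hp1 : p < 1)
    (hweak : ∀ l : X →L[ℂ] ℂ, Tendsto (fun n => l (D.basis n)) atTop (𝓝 0)) (z : ℂ) :
    DenseRange (D.machine p - z • ContinuousLinearMap.id ℂ X) := by
  by_cases hz : z ∈ AddingMachine.filledJulia p
  · refine denseRange_of_forall_dual fun l hl => D.dual_ext l fun n => ?_
    have hl' (v : X) : l (D.machine p v) = z * l v := by
      have := hl v
      rwa [sub_smul_id_apply, map_sub, map_smul, sub_eq_zero] at this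
    have ht : Tendsto (fun k : ℕ => ‖l (D.basis (2 ^ k - 1))‖) atTop (𝓝 0) := by
      simpa using ((hweak l).comp ((tendsto_sub_atTop_nat 1).comp
        (tendsto_pow_atTop_atTop_of_one_lt (one_lt_two (α := ℕ))))).norm
    have hle : ‖l (D.basis n)‖ ≤ 0 := by
      refine ge_of_tendsto ht ?_
      filter_upwards [eventually_ge_atTop n] with k hk
      exact D.norm_left_eigenvector_le hp0 hp1 k hz hl'
        (n.lt_two_pow_self.trans_le (Nat.pow_le_pow_right two_pos hk))
    exact norm_le_zero_iff.1 hle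
  · rw [← D.spectrum_machine hp0 hp1, mem_spectrum_iff, not_not] at hz
    exact hz.2.denseRange

/-! ### The parts of the spectrum -/

theorem pointSpectrum_machine [CompleteSpace X] (hp0 : 0 < p) (hp1 : p < 1) :
    pointSpectrum (D.machine p) = ∅ :=
  Set.eq_empty_of_forall_notMem fun z hz => hz (D.injective_machine_sub hp0 hp1 z)

theorem residualSpectrum_machine [CompleteSpace X] (hp0 : 0 < p) (hp1 : p < 1)
    (hweak : ∀ l : X →L[ℂ] ℂ, Tendsto (fun n => l (D.basis n)) atTop (𝓝 0)) :
    residualSpectrum (D.machine p) = ∅ :=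
  Set.eq_empty_of_forall_notMem fun z hz => hz.2 (D.denseRange_machine_sub hp0 hp1 hweak z)

theorem surjective_machine_sub_iff [CompleteSpace X] (hp0 : 0 < p) (hp1 : p < 1) {z : ℂ} :
    Function.Surjective (D.machine p - z • ContinuousLinearMap.id ℂ X) ↔
      z ∉ AddingMachine.filledJulia p := by
  rw [← D.spectrum_machine hp0 hp1, mem_spectrum_iff, not_not]
  exact ⟨fun h => ⟨D.injective_machine_sub hp0 hp1 z, h⟩, fun h => h.2⟩

theorem contSpectrum_machine [CompleteSpace X] (hp0 : 0 < p) (hp1 : p < 1)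
    (hweak : ∀ l : X →L[ℂ] ℂ, Tendsto (fun n => l (D.basis n)) atTop (𝓝 0)) :
    contSpectrum (D.machine p) = AddingMachine.filledJulia p := by
  ext z
  rw [← not_not (a := z ∈ AddingMachine.filledJulia p), ← D.surjective_machine_sub_iff hp0 hp1]
  exact ⟨fun h => h.2.1, fun h => ⟨D.injective_machine_sub hp0 hp1 z, h,
    D.denseRange_machine_sub hp0 hp1 hweak z⟩⟩

end DyadicSpace

/-! ### Restriction and extension of sequences along an injection -/

namespace Sequence

variable {φ : ℕ → ℕ}

/-- Restriction of sequences along `φ`. -/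
noncomputable def restrict (φ : ℕ → ℕ) : (ℕ → ℂ) →ₗ[ℂ] (ℕ → ℂ) := LinearMap.funLeft ℂ ℂ φ

/-- Extension of sequences by zero along `φ`. -/
noncomputable def extend (φ : ℕ → ℕ) : (ℕ → ℂ) →ₗ[ℂ] (ℕ → ℂ) :=
  Function.ExtendByZero.linearMap ℂ φ

lemma extend_apply (hφ : φ.Injective) (v : ℕ → ℂ) (n : ℕ) : extend φ v (φ n) = v n :=
  hφ.extend_apply v (0 : ℕ → ℂ) n

lemma extend_apply_of_notMem (v : ℕ → ℂ) {n : ℕ} (hn : n ∉ Set.range φ) : extend φ v n = 0 :=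
  Function.extend_apply' v (0 : ℕ → ℂ) n hn

lemma norm_extend_rpow (hφ : φ.Injective) {r : ℝ} (hr : 0 < r) (v : ℕ → ℂ) :
    (fun n => ‖extend φ v n‖ ^ r) = Function.extend φ (fun n => ‖v n‖ ^ r) 0 := by
  funext n
  by_cases hn : n ∈ Set.range φ
  · obtain ⟨k, rfl⟩ := hn
    rw [extend_apply hφ, hφ.extend_apply]
  · rw [extend_apply_of_notMem v hn, Function.extend_apply' _ _ _ hn, norm_zero,
      Real.zero_rpow hr.ne', Pi.zero_apply]

lemma tendsto_extend (hφ : φ.Injective) {v : ℕ → ℂ} (hv : Tendsto v cofinite (𝓝 0)) :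
    Tendsto (extend φ v) cofinite (𝓝 0) := by
  intro s hs
  have h := hv hs
  rw [mem_map, mem_cofinite] at h ⊢
  refine (h.image φ).subset fun n hn => ?_
  by_cases hr : n ∈ Set.range φ
  · obtain ⟨k, rfl⟩ := hr
    refine ⟨k, ?_, rfl⟩
    simpa [extend_apply hφ] using hn
  · exact absurd (mem_of_mem_nhds hs) (by simpa [extend_apply_of_notMem v hr] using hn)

lemma norm_extend_le (hφ : φ.Injective) {v : ℕ → ℂ} {C : ℝ} (hv : ∀ n, ‖v n‖ ≤ C) (n : ℕ) :
    ‖extend φ v n‖ ≤ C := by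
  by_cases hr : n ∈ Set.range φ
  · obtain ⟨k, rfl⟩ := hr
    rw [extend_apply hφ]
    exact hv k
  · rw [extend_apply_of_notMem v hr, norm_zero]
    exact (norm_nonneg _).trans (hv 0)

lemma injective_double : Function.Injective fun n : ℕ => 2 * n := fun _ _ h => by
  simpa using h

lemma injective_double_add_one : Function.Injective fun n : ℕ => 2 * n + 1 := fun _ _ h => by
  simpa using h

lemma odd_notMem_range_double (n : ℕ) : 2 * n + 1 ∉ Set.range fun n : ℕ => 2 * n := by
  rintro ⟨k, hk⟩
  simp only at hk
  omega

lemma even_notMem_range_double_add_one (n : ℕ) : 2 * n ∉ Set.range fun n : ℕ => 2 * n + 1 := by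
  rintro ⟨k, hk⟩
  simp only at hk
  omega

end Sequence

namespace DyadicSpace

theorem tendsto_dual_basis {X : Type*} [NormedAddCommGroup X] [NormedSpace ℂ X]
    (D : DyadicSpace X) {s : ℝ} (hs : s < 1)
    (h : ∀ (F : Finset ℕ) (c : ℕ → ℂ), (∀ n, ‖c n‖ = 1) →
      ‖∑ n ∈ F, c n • D.basis n‖ ≤ (F.card : ℝ) ^ s) (l : X →L[ℂ] ℂ) :
    Tendsto (fun n => l (D.basis n)) atTop (𝓝 0) := by
  choose c hc hcl using fun n => RCLike.exists_norm_eq_mul_self (l (D.basis n))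
  rw [← Nat.cofinite_eq_atTop, Metric.tendsto_nhds]
  intro ε hε
  rw [eventually_cofinite]
  by_contra hinf
  have key (N : ℕ) : (N + 1 : ℕ) * ε ≤ ‖l‖ * ((N + 1 : ℕ) : ℝ) ^ s := by
    obtain ⟨F, hF, hcard⟩ := Set.Infinite.exists_subset_card_eq hinf (N + 1)
    calc ((N + 1 : ℕ) : ℝ) * ε = ∑ n ∈ F, ε := by rw [Finset.sum_const, hcard, nsmul_eq_mul]
      _ ≤ ∑ n ∈ F, ‖l (D.basis n)‖ := Finset.sum_le_sum fun n hn => by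
        simpa using hF hn
      _ = ‖l (∑ n ∈ F, c n • D.basis n)‖ := by
        rw [map_sum]
        simp only [map_smul, smul_eq_mul, ← hcl]
        rw [← RCLike.ofReal_sum, RCLike.norm_ofReal,
          abs_of_nonneg (Finset.sum_nonneg fun _ _ => norm_nonneg _)]
      _ ≤ ‖l‖ * ‖∑ n ∈ F, c n • D.basis n‖ := l.le_opNorm _
      _ ≤ _ := by
        rw [← hcard]
        gcongr
        exact h F c hc
  have key' (N : ℕ) : ε ≤ ‖l‖ * ((N + 1 : ℕ) : ℝ) ^ (-(1 - s)) := by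
    have hN : (0 : ℝ) < (N + 1 : ℕ) := by positivity
    rw [neg_sub, Real.rpow_sub_one hN.ne', ← mul_div_assoc, le_div_iff₀ hN, mul_comm]
    exact key N
  have ht : Tendsto (fun N : ℕ => ‖l‖ * ((N + 1 : ℕ) : ℝ) ^ (-(1 - s))) atTop (𝓝 0) := by
    simpa using ((tendsto_rpow_neg_atTop (sub_pos.2 hs)).comp
      (tendsto_natCast_atTop_atTop.comp (tendsto_add_atTop_nat 1))).const_mul ‖l‖
  exact absurd (ge_of_tendsto' ht key') hε.not_ge

end DyadicSpace

/-! ### The space `c₀` -/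

namespace NullSeq

lemma norm_apply_le (v : C₀(ℕ, ℂ)) (n : ℕ) : ‖v n‖ ≤ ‖v‖ := v.toBCF.norm_coe_le_norm n

lemma norm_le {v : C₀(ℕ, ℂ)} {C : ℝ} (hC : 0 ≤ C) (h : ∀ n, ‖v n‖ ≤ C) : ‖v‖ ≤ C :=
  (BoundedContinuousFunction.norm_le (f := v.toBCF) hC).2 h

lemma tendsto_cofinite (v : C₀(ℕ, ℂ)) : Tendsto v cofinite (𝓝 0) := by
  rw [← cocompact_eq_cofinite]
  exact v.zero_at_infty'

/-- The element of `c₀` given by a null sequence. -/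
def mk (v : ℕ → ℂ) (hv : Tendsto v cofinite (𝓝 0)) : C₀(ℕ, ℂ) where
  toFun := v
  continuous_toFun := continuous_of_discreteTopology
  zero_at_infty' := by rwa [cocompact_eq_cofinite]

@[simp] lemma mk_apply (v : ℕ → ℂ) (hv : Tendsto v cofinite (𝓝 0)) (n : ℕ) : mk v hv n = v n :=
  rfl

/-- The contraction of `c₀` induced by a linear map on sequences. -/
noncomputable def lift (T : (ℕ → ℂ) →ₗ[ℂ] (ℕ → ℂ))
    (h0 : ∀ v, Tendsto v cofinite (𝓝 0) → Tendsto (T v) cofinite (𝓝 0))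
    (h1 : ∀ v C, (∀ n, ‖v n‖ ≤ C) → ∀ n, ‖T v n‖ ≤ C) : C₀(ℕ, ℂ) →L[ℂ] C₀(ℕ, ℂ) :=
  LinearMap.mkContinuous
    { toFun := fun v => mk (T v) (h0 v (tendsto_cofinite v))
      map_add' := fun v w => by
        ext n
        simp
      map_smul' := fun a v => by
        ext n
        simp } 1 fun v => by
    rw [one_mul]
    exact norm_le (norm_nonneg v) (h1 v ‖v‖ (norm_apply_le v))

lemma norm_lift_le (T : (ℕ → ℂ) →ₗ[ℂ] (ℕ → ℂ))
    (h0 : ∀ v, Tendsto v cofinite (𝓝 0) → Tendsto (T v) cofinite (𝓝 0))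
    (h1 : ∀ v C, (∀ n, ‖v n‖ ≤ C) → ∀ n, ‖T v n‖ ≤ C) : ‖lift T h0 h1‖ ≤ 1 :=
  LinearMap.mkContinuous_norm_le _ zero_le_one _

/-- Restriction along an injection as an operator on `c₀`. -/
noncomputable def restrict {φ : ℕ → ℕ} (hφ : φ.Injective) : C₀(ℕ, ℂ) →L[ℂ] C₀(ℕ, ℂ) :=
  lift (Sequence.restrict φ) (fun _ hv => hv.comp hφ.tendsto_cofinite) fun _ _ hv n => hv (φ n)

/-- Extension by zero along an injection as an operator on `c₀`. -/
noncomputable def extend {φ : ℕ → ℕ} (hφ : φ.Injective) : C₀(ℕ, ℂ) →L[ℂ] C₀(ℕ, ℂ) :=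
  lift (Sequence.extend φ) (fun _ hv => Sequence.tendsto_extend hφ hv)
    fun _ _ hv n => Sequence.norm_extend_le hφ hv n

/-- Evaluation at an index as a functional on `c₀`. -/
noncomputable def coord (n : ℕ) : C₀(ℕ, ℂ) →L[ℂ] ℂ :=
  LinearMap.mkContinuous
    { toFun := fun v => v n
      map_add' := fun _ _ => rfl
      map_smul' := fun _ _ => rfl } 1 fun v => by
    rw [one_mul]
    exact norm_apply_le v n

/-- The unit vectors of `c₀`. -/
noncomputable def single (n : ℕ) : C₀(ℕ, ℂ) :=
  mk (Pi.single n 1) <| tendsto_nhds_of_eventually_eq <| by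
    rw [eventually_cofinite]
    refine (Set.finite_singleton n).subset fun m hm => ?_
    by_contra h
    exact hm (Pi.single_eq_of_ne h _)

lemma single_apply (n m : ℕ) : single m n = if n = m then 1 else 0 := Pi.single_apply _ _ _

lemma sum_single_apply (F : Finset ℕ) (c : ℕ → ℂ) (n : ℕ) :
    (∑ m ∈ F, c m • single m) n = if n ∈ F then c n else 0 := by
  change coord n (∑ m ∈ F, c m • single m) = _
  rw [map_sum]
  have (m : ℕ) : coord n (c m • single m) = if n = m then c m else 0 := by
    rw [map_smul, show coord n (single m) = _ from single_apply n m]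
    simp
  simp [this]

lemma dual_ext (l : C₀(ℕ, ℂ) →L[ℂ] ℂ) (h : ∀ n, l (single n) = 0) : l = 0 := by
  ext v
  rw [zero_apply, ← norm_le_zero_iff]
  by_contra! hpos
  set ε := ‖l v‖ / (‖l‖ + 1) with hε
  have hl : 0 < ‖l‖ + 1 := by positivity
  have hε0 : 0 < ε := by positivity
  have hfin := (tendsto_cofinite v) (Metric.ball_mem_nhds 0 hε0)
  rw [mem_map, mem_cofinite] at hfin
  set w := ∑ m ∈ hfin.toFinset, v m • single m with hw
  have hlw : l w = 0 := by
    rw [hw, map_sum]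
    exact Finset.sum_eq_zero fun m _ => by rw [map_smul, h, smul_zero]
  have hvw : ‖v - w‖ ≤ ε := by
    refine norm_le hε0.le fun n => ?_
    rw [ZeroAtInftyContinuousMap.sub_apply, hw, sum_single_apply]
    split_ifs with hn
    · simpa using hε0.le
    · have : ‖v n‖ < ε := by simpa using hn
      simpa using this.le
  have hle : ‖l v‖ ≤ ‖l‖ * ε := by
    calc ‖l v‖ = ‖l (v - w)‖ := by rw [map_sub, hlw, sub_zero]
      _ ≤ ‖l‖ * ‖v - w‖ := l.le_opNorm _
      _ ≤ ‖l‖ * ε := by gcongr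
  have : ‖l v‖ = (‖l‖ + 1) * ε := by
    rw [hε]
    field_simp
  nlinarith

open Sequence in
/-- The dyadic structure of `c₀`. -/
noncomputable def dyadicSpace : DyadicSpace C₀(ℕ, ℂ) where
  coord := coord
  ext h := ZeroAtInftyContinuousMap.ext h
  tendsto_coord v := Nat.cofinite_eq_atTop ▸ tendsto_cofinite v
  evens := restrict injective_double
  odds := restrict injective_double_add_one
  spreadEven := extend injective_double
  spreadOdd := extend injective_double_add_one
  coord_evens _ _ := rfl
  coord_odds _ _ := rfl
  coord_spreadEven_even n v := extend_apply injective_double v n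
  coord_spreadEven_odd n v := extend_apply_of_notMem v (odd_notMem_range_double n)
  coord_spreadOdd_even n v := extend_apply_of_notMem v (even_notMem_range_double_add_one n)
  coord_spreadOdd_odd n v := extend_apply injective_double_add_one v n
  norm_evens_le := norm_lift_le _ _ _
  norm_spreadOdd_le := norm_lift_le _ _ _
  basis := single
  coord_basis := single_apply
  dual_ext := dual_ext

lemma tendsto_dual_basis (l : C₀(ℕ, ℂ) →L[ℂ] ℂ) :
    Tendsto (fun n => l (dyadicSpace.basis n)) atTop (𝓝 0) := by
  refine dyadicSpace.tendsto_dual_basis zero_lt_one (fun F c hc => ?_) l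
  rw [Real.rpow_zero]
  refine norm_le zero_le_one fun n => ?_
  rw [show dyadicSpace.basis = single from rfl, sum_single_apply]
  split_ifs <;> simp [hc]

end NullSeq

/-! ### The spaces `ℓ^α` -/

namespace SummableSeq

variable {α : ℝ≥0∞} [Fact (1 ≤ α)]

lemma toReal_pos (hα : α ≠ ∞) : 0 < α.toReal :=
  ENNReal.toReal_pos (zero_lt_one.trans_le Fact.out).ne' hα

/-- The contraction of `ℓ^α` induced by a linear map on sequences. -/
noncomputable def lift (hα : α ≠ ∞) (T : (ℕ → ℂ) →ₗ[ℂ] (ℕ → ℂ))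
    (h : ∀ v, Summable (fun n => ‖v n‖ ^ α.toReal) →
      Summable (fun n => ‖T v n‖ ^ α.toReal) ∧
        ∑' n, ‖T v n‖ ^ α.toReal ≤ ∑' n, ‖v n‖ ^ α.toReal) :
    lp (fun _ : ℕ => ℂ) α →L[ℂ] lp (fun _ : ℕ => ℂ) α :=
  LinearMap.mkContinuous
    { toFun := fun v => ⟨T v, memℓp_gen (h v ((lp.memℓp v).summable (toReal_pos hα))).1⟩
      map_add' := fun v w => lp.ext (map_add T (v : ℕ → ℂ) w)
      map_smul' := fun a v => lp.ext (map_smul T a (v : ℕ → ℂ)) } 1 fun v => by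
    rw [one_mul]
    refine lp.norm_le_of_tsum_le (toReal_pos hα) (norm_nonneg v) ?_
    rw [lp.norm_rpow_eq_tsum (toReal_pos hα)]
    exact (h v ((lp.memℓp v).summable (toReal_pos hα))).2

lemma norm_lift_le (hα : α ≠ ∞) (T : (ℕ → ℂ) →ₗ[ℂ] (ℕ → ℂ))
    (h : ∀ v, Summable (fun n => ‖v n‖ ^ α.toReal) →
      Summable (fun n => ‖T v n‖ ^ α.toReal) ∧
        ∑' n, ‖T v n‖ ^ α.toReal ≤ ∑' n, ‖v n‖ ^ α.toReal) : ‖lift hα T h‖ ≤ 1 :=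
  LinearMap.mkContinuous_norm_le _ zero_le_one _

/-- Restriction along an injection as an operator on `ℓ^α`. -/
noncomputable def restrict (hα : α ≠ ∞) {φ : ℕ → ℕ} (hφ : φ.Injective) :
    lp (fun _ : ℕ => ℂ) α →L[ℂ] lp (fun _ : ℕ => ℂ) α :=
  lift hα (Sequence.restrict φ) fun v hv => by
    refine ⟨hv.comp_injective hφ, ?_⟩
    exact tsum_comp_le_tsum_of_inj hv (fun n => by positivity) hφ

/-- Extension by zero along an injection as an operator on `ℓ^α`. -/
noncomputable def extend (hα : α ≠ ∞) {φ : ℕ → ℕ} (hφ : φ.Injective) :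
    lp (fun _ : ℕ => ℂ) α →L[ℂ] lp (fun _ : ℕ => ℂ) α :=
  lift hα (Sequence.extend φ) fun v hv => by
    rw [Sequence.norm_extend_rpow hφ (toReal_pos hα)]
    have := (hasSum_extend_zero hφ).2 hv.hasSum
    exact ⟨this.summable, this.tsum_eq.le⟩

/-- Evaluation at an index as a functional on `ℓ^α`. -/
noncomputable def coord (α : ℝ≥0∞) [Fact (1 ≤ α)] (n : ℕ) : lp (fun _ : ℕ => ℂ) α →L[ℂ] ℂ :=
  LinearMap.mkContinuous
    { toFun := fun v => v n
      map_add' := fun _ _ => rfl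
      map_smul' := fun _ _ => rfl } 1 fun v => by
    rw [one_mul]
    exact lp.norm_apply_le_norm (zero_lt_one.trans_le Fact.out).ne' v n

lemma tendsto_cofinite (hα : α ≠ ∞) (v : lp (fun _ : ℕ => ℂ) α) :
    Tendsto v cofinite (𝓝 0) := by
  have hr := toReal_pos hα
  have h := ((lp.memℓp v).summable hr).tendsto_cofinite_zero.rpow_const
    (p := α.toReal⁻¹) (Or.inr (by positivity))
  rw [Real.zero_rpow (by positivity)] at h
  refine tendsto_zero_iff_norm_tendsto_zero.2 (h.congr fun n => ?_)
  exact Real.rpow_rpow_inv (norm_nonneg _) hr.ne'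

lemma dual_ext (hα : α ≠ ∞) (l : lp (fun _ : ℕ => ℂ) α →L[ℂ] ℂ)
    (h : ∀ n, l (lp.single α n 1) = 0) : l = 0 := by
  ext v
  have hs := (lp.hasSum_single hα v).mapL l
  have h0 (n : ℕ) : l (lp.single α n (v n)) = 0 := by
    rw [← mul_one (v n), ← smul_eq_mul, lp.single_smul, map_smul, h, smul_zero]
  simp only [h0] at hs
  exact hs.unique hasSum_zero

open Sequence in
/-- The dyadic structure of `ℓ^α`. -/
noncomputable def dyadicSpace (hα : α ≠ ∞) : DyadicSpace (lp (fun _ : ℕ => ℂ) α) where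
  coord := coord α
  ext h := lp.ext (funext h)
  tendsto_coord v := Nat.cofinite_eq_atTop ▸ tendsto_cofinite hα v
  evens := restrict hα injective_double
  odds := restrict hα injective_double_add_one
  spreadEven := extend hα injective_double
  spreadOdd := extend hα injective_double_add_one
  coord_evens _ _ := rfl
  coord_odds _ _ := rfl
  coord_spreadEven_even n v := extend_apply injective_double v n
  coord_spreadEven_odd n v := extend_apply_of_notMem v (odd_notMem_range_double n)
  coord_spreadOdd_even n v := extend_apply_of_notMem v (even_notMem_range_double_add_one n)
  coord_spreadOdd_odd n v := extend_apply injective_double_add_one v n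
  norm_evens_le := norm_lift_le _ _ _
  norm_spreadOdd_le := norm_lift_le _ _ _
  basis n := lp.single α n 1
  coord_basis n m := by
    change lp.single (E := fun _ : ℕ => ℂ) α m 1 n = _
    rw [lp.coeFn_single, Pi.single_apply]
  dual_ext := dual_ext hα

lemma tendsto_dual_basis (hα : α ≠ ∞) (hα1 : 1 < α) (l : lp (fun _ : ℕ => ℂ) α →L[ℂ] ℂ) :
    Tendsto (fun n => l ((dyadicSpace hα).basis n)) atTop (𝓝 0) := by
  have hr := toReal_pos hα
  have h1 : 1 < α.toReal := by
    rwa [← ENNReal.toReal_one, ENNReal.toReal_lt_toReal ENNReal.one_ne_top hα]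
  refine (dyadicSpace hα).tendsto_dual_basis (inv_lt_one_of_one_lt₀ h1) (fun F c hc => ?_) l
  have h := lp.norm_sum_single (E := fun _ : ℕ => ℂ) hr c F
  simp only [hc, Real.one_rpow, Finset.sum_const, nsmul_eq_mul, mul_one] at h
  rw [← h, Real.rpow_rpow_inv (norm_nonneg _) hr.ne']
  refine le_of_eq (congrArg norm (Finset.sum_congr rfl fun n _ => ?_))
  change c n • lp.single α n 1 = _
  rw [← lp.single_smul, smul_eq_mul, mul_one]

end SummableSeq

/-! ### Adjoining a fixed vector -/

/-- `Y` is the direct sum of `X` and the line through `one`. -/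
structure AdjoinLine (X Y : Type*) [NormedAddCommGroup X] [NormedSpace ℂ X]
    [NormedAddCommGroup Y] [NormedSpace ℂ Y] where
  incl : X →L[ℂ] Y
  proj : Y →L[ℂ] X
  limit : Y →L[ℂ] ℂ
  one : Y
  limit_incl : ∀ v, limit (incl v) = 0
  limit_one : limit one = 1
  proj_incl : ∀ v, proj (incl v) = v
  proj_one : proj one = 0
  incl_proj_add : ∀ v, incl (proj v) + limit v • one = v

namespace AdjoinLine

variable {X Y : Type*} [NormedAddCommGroup X] [NormedSpace ℂ X] [NormedAddCommGroup Y]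
  [NormedSpace ℂ Y] (A : AdjoinLine X Y)

lemma ext_proj_limit {v w : Y} (hp : A.proj v = A.proj w) (hl : A.limit v = A.limit w) :
    v = w := by
  rw [← A.incl_proj_add v, ← A.incl_proj_add w, hp, hl]

/-- The operator on `Y` that acts as `T` on `X` and multiplies `one` by `a`. -/
noncomputable def extendOp (T : X →L[ℂ] X) (a : ℂ) :
    Y →L[ℂ] Y :=
  A.incl ∘L T ∘L A.proj + A.limit.smulRight (a • A.one)

lemma extendOp_apply (T : X →L[ℂ] X) (a : ℂ) (v : Y) :
    A.extendOp T a v = A.incl (T (A.proj v)) + A.limit v • a • A.one := rfl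

lemma proj_extendOp (T : X →L[ℂ] X) (a : ℂ) (v : Y) :
    A.proj (A.extendOp T a v) = T (A.proj v) := by
  simp [A.extendOp_apply, A.proj_incl, A.proj_one]

lemma limit_extendOp (T : X →L[ℂ] X) (a : ℂ) (v : Y) :
    A.limit (A.extendOp T a v) = a * A.limit v := by
  simp [A.extendOp_apply, A.limit_incl, A.limit_one, mul_comm]

lemma extendOp_sub (T : X →L[ℂ] X) (a z : ℂ) :
    A.extendOp T a - z • ContinuousLinearMap.id ℂ Y =
      A.extendOp (T - z • ContinuousLinearMap.id ℂ X) (a - z) := by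
  refine ContinuousLinearMap.ext fun v => A.ext_proj_limit ?_ ?_
  · rw [A.proj_extendOp, DyadicSpace.sub_smul_id_apply, DyadicSpace.sub_smul_id_apply, map_sub,
      map_smul, A.proj_extendOp]
  · rw [A.limit_extendOp, DyadicSpace.sub_smul_id_apply, map_sub, map_smul, A.limit_extendOp,
      smul_eq_mul, sub_mul]

lemma extendOp_mul (T U : X →L[ℂ] X) (a b : ℂ) :
    A.extendOp T a * A.extendOp U b = A.extendOp (T * U) (a * b) := by
  refine ContinuousLinearMap.ext fun v => A.ext_proj_limit ?_ ?_
  · simp [A.proj_extendOp]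
  · simp [A.limit_extendOp, mul_assoc]

lemma extendOp_one : A.extendOp 1 1 = 1 := by
  refine ContinuousLinearMap.ext fun v => A.ext_proj_limit ?_ ?_
  · simp [A.proj_extendOp]
  · simp [A.limit_extendOp]

lemma isUnit_extendOp {T : X →L[ℂ] X} {a : ℂ} (hT : IsUnit T) (ha : a ≠ 0) :
    IsUnit (A.extendOp T a) := by
  obtain ⟨u, rfl⟩ := hT
  exact ⟨⟨A.extendOp u a, A.extendOp ↑u⁻¹ a⁻¹, by simp [A.extendOp_mul, ha, A.extendOp_one],
    by simp [A.extendOp_mul, ha, A.extendOp_one]⟩, rfl⟩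

lemma surjective_of_surjective_extendOp {T : X →L[ℂ] X} {a : ℂ}
    (h : Function.Surjective (A.extendOp T a)) : Function.Surjective T := fun w => by
  obtain ⟨v, hv⟩ := h (A.incl w)
  exact ⟨A.proj v, by rw [← A.proj_extendOp T a, hv, A.proj_incl]⟩

lemma injective_extendOp_iff {T : X →L[ℂ] X} {a : ℂ} (hT : Function.Injective T) :
    Function.Injective (A.extendOp T a) ↔ a ≠ 0 := by
  constructor
  · rintro h rfl
    have h1 : A.one = 0 := h <| A.ext_proj_limit (by simp [A.proj_extendOp, A.proj_one])
      (by simp [A.limit_extendOp])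
    have := A.limit_one
    rw [h1, map_zero] at this
    exact zero_ne_one this
  · intro ha v w h
    refine A.ext_proj_limit (hT ?_) (mul_left_cancel₀ ha ?_)
    · rw [← A.proj_extendOp T a, h, A.proj_extendOp]
    · rw [← A.limit_extendOp T a, h, A.limit_extendOp]

lemma denseRange_extendOp {T : X →L[ℂ] X} {a : ℂ} (hT : DenseRange T)
    (ha : a ≠ 0) : DenseRange (A.extendOp T a) := by
  have hs : Function.Surjective fun x : X × ℂ => A.incl x.1 + x.2 • A.one :=
    fun v => ⟨(A.proj v, A.limit v), A.incl_proj_add v⟩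
  have hc : Continuous fun x : X × ℂ => A.incl x.1 + x.2 • A.one := by fun_prop
  have h := hs.denseRange.comp (hT.prodMap (mul_left_surjective₀ ha).denseRange) hc
  refine DenseRange.of_comp (g := fun x : X × ℂ => A.incl x.1 + x.2 • A.one) ?_
  convert h using 1
  funext x
  refine A.ext_proj_limit ?_ ?_
  · simp [A.proj_extendOp, A.proj_incl, A.proj_one]
  · simp [A.limit_extendOp, A.limit_incl, A.limit_one, mul_comm]

lemma injective_extendOp_sub_iff {T : X →L[ℂ] X}
    (hinj : ∀ z : ℂ, Function.Injective (T - z • ContinuousLinearMap.id ℂ X)) {a z : ℂ} :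
    Function.Injective (A.extendOp T a - z • ContinuousLinearMap.id ℂ Y) ↔ z ≠ a := by
  rw [extendOp_sub, A.injective_extendOp_iff (hinj z), sub_ne_zero, ne_comm]

lemma denseRange_extendOp_sub {T : X →L[ℂ] X}
    (hdense : ∀ z : ℂ, DenseRange (T - z • ContinuousLinearMap.id ℂ X)) {a z : ℂ} (hz : z ≠ a) :
    DenseRange (A.extendOp T a - z • ContinuousLinearMap.id ℂ Y) := by
  rw [extendOp_sub]
  exact A.denseRange_extendOp (hdense z) (sub_ne_zero.2 hz.symm)

lemma surjective_of_isUnit {T : Y →L[ℂ] Y} (h : IsUnit T) : Function.Surjective T := by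
  obtain ⟨U, hU⟩ := h.exists_right_inv
  exact fun v => ⟨U v, DFunLike.congr_fun hU v⟩

lemma surjective_extendOp_sub_iff [CompleteSpace X] {T : X →L[ℂ] X}
    (hinj : ∀ z : ℂ, Function.Injective (T - z • ContinuousLinearMap.id ℂ X)) {a z : ℂ}
    (ha : a ∈ spectrum ℂ T) :
    Function.Surjective (A.extendOp T a - z • ContinuousLinearMap.id ℂ Y) ↔
      z ∉ spectrum ℂ T := by
  rw [extendOp_sub]
  refine ⟨fun h => ?_, fun h => ?_⟩
  · rw [DyadicSpace.mem_spectrum_iff, not_not]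
    exact ⟨hinj z, A.surjective_of_surjective_extendOp h⟩
  · have hz : z ≠ a := fun hz => h (hz ▸ ha)
    rw [DyadicSpace.mem_spectrum_iff_not_isUnit, not_not] at h
    exact surjective_of_isUnit (A.isUnit_extendOp h (sub_ne_zero.2 hz.symm))

theorem spectrum_extendOp [CompleteSpace X] {T : X →L[ℂ] X}
    (hinj : ∀ z : ℂ, Function.Injective (T - z • ContinuousLinearMap.id ℂ X)) {a : ℂ}
    (ha : a ∈ spectrum ℂ T) : spectrum ℂ (A.extendOp T a) = spectrum ℂ T := by
  ext z
  rw [DyadicSpace.mem_spectrum_iff_not_isUnit, not_iff_comm]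
  refine ⟨fun h => ?_, fun h => (A.surjective_extendOp_sub_iff hinj ha).1 (surjective_of_isUnit h)⟩
  have hz : z ≠ a := fun hz => h (hz ▸ ha)
  rw [DyadicSpace.mem_spectrum_iff_not_isUnit, not_not] at h
  rw [extendOp_sub]
  exact A.isUnit_extendOp h (sub_ne_zero.2 hz.symm)

theorem pointSpectrum_extendOp {T : X →L[ℂ] X}
    (hinj : ∀ z : ℂ, Function.Injective (T - z • ContinuousLinearMap.id ℂ X)) (a : ℂ) :
    pointSpectrum (A.extendOp T a) = {a} :=
  Set.ext fun _ => (A.injective_extendOp_sub_iff hinj).not.trans not_not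

theorem residualSpectrum_extendOp {T : X →L[ℂ] X}
    (hinj : ∀ z : ℂ, Function.Injective (T - z • ContinuousLinearMap.id ℂ X))
    (hdense : ∀ z : ℂ, DenseRange (T - z • ContinuousLinearMap.id ℂ X)) (a : ℂ) :
    residualSpectrum (A.extendOp T a) = ∅ :=
  Set.eq_empty_of_forall_notMem fun _ hz =>
    hz.2 (A.denseRange_extendOp_sub hdense ((A.injective_extendOp_sub_iff hinj).1 hz.1))

theorem contSpectrum_extendOp [CompleteSpace X] {T : X →L[ℂ] X}
    (hinj : ∀ z : ℂ, Function.Injective (T - z • ContinuousLinearMap.id ℂ X))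
    (hdense : ∀ z : ℂ, DenseRange (T - z • ContinuousLinearMap.id ℂ X)) {a : ℂ}
    (ha : a ∈ spectrum ℂ T) : contSpectrum (A.extendOp T a) = spectrum ℂ T \ {a} := by
  ext z
  refine ⟨fun ⟨hi, hs, _⟩ => ⟨?_, (A.injective_extendOp_sub_iff hinj).1 hi⟩, fun ⟨hz, hne⟩ =>
    ⟨(A.injective_extendOp_sub_iff hinj).2 hne, ?_, A.denseRange_extendOp_sub hdense hne⟩⟩
  · rwa [A.surjective_extendOp_sub_iff hinj ha, not_not] at hs
  · rwa [A.surjective_extendOp_sub_iff hinj ha, not_not]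

end AdjoinLine

/-! ### The space `c` -/

open AddingMachine in
lemma AddingMachine.hasSum_transitionProb (p : unitInterval) (n : ℕ) :
    HasSum (fun m => (transitionProb p n m : ℂ)) 1 := by
  induction n using Nat.strong_induction_on with
  | _ n ih =>
    obtain ⟨k, rfl | rfl⟩ := n.even_or_odd'
    · rw [← sub_add_cancel (1 : ℂ) ((p : ℝ) : ℂ)]
      refine HasSum.even_add_odd ?_ ?_
      · convert hasSum_single k fun m hm => ?_ using 1
        · simp [transitionProb_even_even]
        · simp [transitionProb_even_even, hm.symm]
      · convert hasSum_single k fun m hm => ?_ using 1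
        · simp [transitionProb_even_odd]
        · simp [transitionProb_even_odd, hm.symm]
    · rw [← add_sub_cancel ((p : ℝ) : ℂ) (1 : ℂ)]
      refine HasSum.even_add_odd ?_ ?_
      · simpa [transitionProb_odd_even] using (ih k (by omega)).mul_left ((p : ℝ) : ℂ)
      · convert hasSum_single k fun m hm => ?_ using 1
        · simp [transitionProb_odd_odd]
        · simp [transitionProb_odd_odd, hm.symm]

namespace ConvergentSeq

lemma ext {v w : convergentSeq} (h : ∀ n, v.1 n = w.1 n) : v = w :=
  Subtype.ext (lp.ext (funext h))

lemma norm_apply_le (v : convergentSeq) (n : ℕ) : ‖v.1 n‖ ≤ ‖v‖ :=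
  lp.norm_apply_le_norm ENNReal.top_ne_zero v.1 n

/-- The limit of a convergent sequence. -/
noncomputable def limit (v : convergentSeq) : ℂ := v.2.choose

lemma tendsto_limit (v : convergentSeq) : Tendsto (fun n => v.1 n) atTop (𝓝 (limit v)) :=
  v.2.choose_spec

lemma limit_eq {v : convergentSeq} {l : ℂ} (h : Tendsto (fun n => v.1 n) atTop (𝓝 l)) :
    limit v = l := tendsto_nhds_unique (tendsto_limit v) h

/-- The limit functional on `c`. -/
noncomputable def limitL : convergentSeq →L[ℂ] ℂ :=
  LinearMap.mkContinuous
    { toFun := limit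
      map_add' := fun v w => limit_eq ((tendsto_limit v).add (tendsto_limit w))
      map_smul' := fun a v => limit_eq ((tendsto_limit v).const_mul a) } 1 fun v => by
    rw [one_mul]
    exact le_of_tendsto' (tendsto_limit v).norm (norm_apply_le v)

/-- The constant sequence `1`. -/
noncomputable def one : convergentSeq := ⟨1, 1, tendsto_const_nhds⟩

/-- The inclusion of `c₀` in `c`. -/
noncomputable def incl : C₀(ℕ, ℂ) →L[ℂ] convergentSeq :=
  LinearMap.mkContinuous
    { toFun := fun v => ⟨⟨fun n => v n, memℓp_infty ⟨‖v‖, by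
        rintro _ ⟨n, rfl⟩
        exact NullSeq.norm_apply_le v n⟩⟩, 0, Nat.cofinite_eq_atTop ▸ NullSeq.tendsto_cofinite v⟩
      map_add' := fun _ _ => ext fun _ => rfl
      map_smul' := fun _ _ => ext fun _ => rfl } 1 fun v => by
    rw [one_mul]
    exact lp.norm_le_of_forall_le (norm_nonneg v) (NullSeq.norm_apply_le v)

/-- The projection of `c` onto `c₀` along the constant sequences. -/
noncomputable def proj : convergentSeq →L[ℂ] C₀(ℕ, ℂ) :=
  LinearMap.mkContinuous
    { toFun := fun v => NullSeq.mk (fun n => v.1 n - limitL v) <| by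
        rw [Nat.cofinite_eq_atTop, ← sub_self (limitL v)]
        exact (tendsto_limit v).sub_const _
      map_add' := fun v w => by
        ext n
        change v.1 n + w.1 n - limitL (v + w) = v.1 n - limitL v + (w.1 n - limitL w)
        rw [map_add]
        ring
      map_smul' := fun a v => by
        ext n
        change a * v.1 n - limitL (a • v) = a * (v.1 n - limitL v)
        rw [map_smul, smul_eq_mul]
        ring } (1 + ‖limitL‖) fun v => by
    refine NullSeq.norm_le (by positivity) fun n => ?_
    refine (norm_sub_le _ _).trans ?_
    rw [add_mul, one_mul]
    exact add_le_add (norm_apply_le v n) (limitL.le_opNorm v)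

lemma proj_apply (v : convergentSeq) (n : ℕ) : proj v n = v.1 n - limitL v := rfl

lemma incl_apply (v : C₀(ℕ, ℂ)) (n : ℕ) : (incl v).1 n = v n := rfl

lemma limitL_incl (v : C₀(ℕ, ℂ)) : limitL (incl v) = 0 :=
  limit_eq (Nat.cofinite_eq_atTop ▸ NullSeq.tendsto_cofinite v)

lemma limitL_one : limitL one = 1 := limit_eq tendsto_const_nhds

lemma proj_incl (v : C₀(ℕ, ℂ)) : proj (incl v) = v := by
  ext n
  rw [proj_apply, limitL_incl, sub_zero, incl_apply]

lemma proj_one : proj one = 0 := by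
  ext n
  rw [proj_apply, limitL_one]
  exact sub_self 1

lemma incl_proj_add (v : convergentSeq) : incl (proj v) + limitL v • one = v :=
  ext fun n => by
    change v.1 n - limitL v + limitL v * 1 = v.1 n
    ring

/-- `c` is the direct sum of `c₀` and the constant sequences. -/
noncomputable def adjoinLine : AdjoinLine C₀(ℕ, ℂ) convergentSeq where
  incl := incl
  proj := proj
  limit := limitL
  one := one
  limit_incl := limitL_incl
  limit_one := limitL_one
  proj_incl := proj_incl
  proj_one := proj_one
  incl_proj_add := incl_proj_add

/-- The transition operator of the adding machine on `c`. -/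
noncomputable def machine (p : unitInterval) : convergentSeq →L[ℂ] convergentSeq :=
  adjoinLine.extendOp (NullSeq.dyadicSpace.machine p) 1

lemma isImage_machine {p : unitInterval} (hp1 : p < 1) (v : convergentSeq) :
    AddingMachine.IsImage p (fun n => v.1 n) (fun n => (machine p v).1 n) := by
  intro n
  have h := (NullSeq.dyadicSpace.isImage_machine hp1 (proj v) n).add
    ((AddingMachine.hasSum_transitionProb p n).mul_right (limitL v))
  convert h using 1
  · funext m
    change _ = _ * (v.1 m - limitL v) + _
    ring
  · change NullSeq.dyadicSpace.machine p (proj v) n + limitL v * (1 * 1) =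
      NullSeq.dyadicSpace.machine p (proj v) n + 1 * limitL v
    ring

end ConvergentSeq

/-- On each of `c₀`, `c` and `ℓ^α`, `1 ≤ α < ∞`, the transition matrix defines a bounded operator,
which is unique because its values are given entry by entry, and its spectrum and the parts of the
spectrum are as stated. -/
theorem theorem1 (p : unitInterval) (hp0 : 0 < p) (hp1 : p < 1) :
    (∃ S : C₀(ℕ, ℂ) →L[ℂ] C₀(ℕ, ℂ),
      (∀ v, AddingMachine.IsImage p (fun n => v n) (fun n => S v n)) ∧
      spectrum ℂ S = AddingMachine.filledJulia p ∧
      contSpectrum S = AddingMachine.filledJulia p ∧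
      pointSpectrum S = ∅ ∧
      residualSpectrum S = ∅) ∧
    (∃ S : convergentSeq →L[ℂ] convergentSeq,
      (∀ v, AddingMachine.IsImage p (fun n => v.1 n) (fun n => (S v).1 n)) ∧
      spectrum ℂ S = AddingMachine.filledJulia p ∧
      pointSpectrum S = {1} ∧
      residualSpectrum S = ∅ ∧
      contSpectrum S = AddingMachine.filledJulia p \ {1}) ∧
    (∀ (α : ℝ≥0∞) [Fact (1 ≤ α)], α ≠ ∞ →
      ∃ S : lp (fun _ : ℕ => ℂ) α →L[ℂ] lp (fun _ : ℕ => ℂ) α,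
        (∀ v, AddingMachine.IsImage p (fun n => v n) (fun n => S v n)) ∧
        spectrum ℂ S = AddingMachine.filledJulia p ∧
        (1 < α →
          contSpectrum S = AddingMachine.filledJulia p ∧
          pointSpectrum S = ∅ ∧
          residualSpectrum S = ∅)) := by
  refine ⟨⟨NullSeq.dyadicSpace.machine p, NullSeq.dyadicSpace.isImage_machine hp1,
    NullSeq.dyadicSpace.spectrum_machine hp0 hp1,
    NullSeq.dyadicSpace.contSpectrum_machine hp0 hp1 NullSeq.tendsto_dual_basis,
    NullSeq.dyadicSpace.pointSpectrum_machine hp0 hp1,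
    NullSeq.dyadicSpace.residualSpectrum_machine hp0 hp1 NullSeq.tendsto_dual_basis⟩,
    ⟨ConvergentSeq.machine p, ConvergentSeq.isImage_machine hp1, ?_⟩, fun α _ hα => ?_⟩
  · have hS := NullSeq.dyadicSpace.spectrum_machine hp0 hp1
    have hinj := NullSeq.dyadicSpace.injective_machine_sub hp0 hp1
    have hdense := NullSeq.dyadicSpace.denseRange_machine_sub hp0 hp1 NullSeq.tendsto_dual_basis
    have h1 : (1 : ℂ) ∈ spectrum ℂ (NullSeq.dyadicSpace.machine p) :=
      hS ▸ AddingMachine.one_mem_filledJulia hp0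
    refine ⟨?_, ConvergentSeq.adjoinLine.pointSpectrum_extendOp hinj 1,
      ConvergentSeq.adjoinLine.residualSpectrum_extendOp hinj hdense 1, ?_⟩
    · exact (ConvergentSeq.adjoinLine.spectrum_extendOp hinj h1).trans hS
    · rw [← hS]
      exact ConvergentSeq.adjoinLine.contSpectrum_extendOp hinj hdense h1
  let D := SummableSeq.dyadicSpace hα
  refine ⟨D.machine p, D.isImage_machine hp1, D.spectrum_machine hp0 hp1, fun hα1 => ?_⟩
  have hweak := SummableSeq.tendsto_dual_basis hα hα1
  exact ⟨D.contSpectrum_machine hp0 hp1 hweak, D.pointSpectrum_machine hp0 hp1,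
    D.residualSpectrum_machine hp0 hp1 hweak⟩
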